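/- Theorem 6 (Parameter-dependent Yakubovich Lemma). Notation: $\mathbb{H}\mathbb{M}_k$ is the space of Hermitian complex $k\times k$ matrices; for Hermitian matrices $A>B$ means that $A-B$ is positive definite; $\mathcal{C}(X,Y)$ is the space of continuous functions from $X$ to the normed space $Y$ with the sup norm ($X$ compact); $\bar{\mathbb{C}}=\mathbb{C}\cup\{\infty\}$. For $\Theta=(\theta_{ij})\in\mathbb{H}\mathbb{M}_2$ put $$\Gamma_\Theta=\{\lambda\in\bar{\mathbb{C}}:(\lambda,1)\Theta(\lambda,1)^*=0\},\qquad \Omega_\Theta=\{\lambda\in\bar{\mathbb{C}}:(\lambda,1)\Theta(\lambda,1)^*\ge 0\},$$ and for complex $n\times n_z$ matrices $M,N$ and Hermitian $H$ of order $n$ put $$\Lambda'_{M,N,\Theta}(H)=(M^*,N^*)(\Theta^\top\otimes H)(M^*,N^*)^*.$$ At $\lambda=\infty$ the row $(\lambda,1)$ is read as $(1,0)$ and the matrix $\lambda N-M$ as $N$; thus $\infty\in\Gamma_\Theta$ iff $\theta_{11}=0$, and $\infty\in\Omega_\Theta$ iff $\theta_{11}\ge0$. Let $\mathcal{D}$ be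 a compact topological space, let $G_{ij}\in\mathcal{C}(\mathcal{D},\mathbb{C}^{n_z\times n_z})$ with $G_{ij}(p)=G_{ji}(p)^*$ for all $p\in\mathcal{D}$, $i,j=1,\dots,m$, let $M,N\in\mathcal{C}(\mathcal{D},\mathbb{C}^{n\times n_z})$, and let $\Theta_1,\Theta_2\in\mathcal{C}(\mathcal{D},\mathbb{H}\mathbb{M}_2)$ with $\det\Theta_i(p)<0$ for all $p\in\mathcal{D}$, $i=1,2$. Let $G(p)=(G_{ij}(p))_{i,j=1}^m$ be the block matrix with blocks $G_{ij}(p)$. Suppose that $\Gamma_{\Theta_1(p)}\cap\Omega_{\Theta_2(p)}$ contains more than one point for every $p\in\mathcal{D}$, and that either $m=1$ and $n_z>n$, or $m>1$, $n_z=n+1$ and $\operatorname{rank}(\lambda N(p)-M(p))=n$ for all $p\in\mathcal{D}$ and all $\lambda\in\Gamma_{\Theta_1(p)}\cap\Omega_{\Theta_2(p)}$. Then the following two statements are equivalent. 1. The $m\times m$ matrix inequality $\big(z^*G_{ij}(p)z\big)_{i,j=1}^m>0$ holds for all $p\in\mathcal{D}$, all $z\in\mathbb{C}^{n_z}$, $z\ne0$,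 and all $\lambda\in\Gamma_{\Theta_1(p)}\cap\Omega_{\Theta_2(p)}$ such that $(\lambda N(p)-M(p))z=0$. 2. There exist $H_1,H_2\in\mathcal{C}(\mathcal{D},\mathbb{H}\mathbb{M}_{mn})$ such that for all $p\in\mathcal{D}$ $$H_2(p)>0,\qquad G(p)>\Lambda'_{I_m\otimes M(p),\,I_m\otimes N(p),\,\Theta_1(p)}(H_1(p))+\Lambda'_{I_m\otimes M(p),\,I_m\otimes N(p),\,\Theta_2(p)}(H_2(p)).\qquad(*)$$ Moreover, the set of continuous pairs $(H_1,H_2)$ satisfying $(*)$ for all $p\in\mathcal{D}$ is open in $\mathcal{C}(\mathcal{D},\mathbb{H}\mathbb{M}_{mn}\times\mathbb{H}\mathbb{M}_{mn})$. -/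

import Mathlib

open scoped ComplexOrder Kronecker

/-- The real vector space of Hermitian complex matrices with rows and columns indexed by `ι`,
with the topology induced from the space of all matrices. -/
abbrev HermMat (ι : Type*) : Type _ := selfAdjoint (Matrix ι ι ℂ)

/-- Homogeneous coordinates of a point of the closed complex plane `ℂ ∪ {∞}`: a finite `l` has
coordinates `(l, 1)` and `∞` has coordinates `(1, 0)`. -/
def homCoord (l : OnePoint ℂ) : Fin 2 → ℂ :=
  OnePoint.elim l ![1, 0] (fun c : ℂ => ![c, 1])

/-- The value `(l, 1) Θ (l, 1)^*`, in homogeneous coordinates; at `l = ∞` it is the upper left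
entry of `Θ`. -/
def thetaForm (Θ : Matrix (Fin 2) (Fin 2) ℂ) (l : OnePoint ℂ) : ℂ :=
  Matrix.vecMul (homCoord l) Θ ⬝ᵥ star (homCoord l)

/-- The curve `Γ_Θ` in the closed complex plane. -/
def thetaCurve (Θ : Matrix (Fin 2) (Fin 2) ℂ) : Set (OnePoint ℂ) :=
  {l | thetaForm Θ l = 0}

/-- The domain `Ω_Θ` in the closed complex plane. (For Hermitian `Θ` the form is real valued.) -/
def thetaDomain (Θ : Matrix (Fin 2) (Fin 2) ℂ) : Set (OnePoint ℂ) :=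
  {l | 0 ≤ thetaForm Θ l}

/-- The matrix `l N - M`, in homogeneous coordinates; at `l = ∞` it is `N`. -/
def pencil {ι κ : Type*} (M N : Matrix ι κ ℂ) (l : OnePoint ℂ) : Matrix ι κ ℂ :=
  homCoord l 0 • N - homCoord l 1 • M

/-- The block row `(A, B)`. -/
def blockRow {ι κ : Type*} (A B : Matrix ι κ ℂ) : Matrix ι (Fin 2 × κ) ℂ :=
  Matrix.of fun i k => (![A, B] k.1) i k.2

/-- The operator `Λ'_{M,N,Θ}(H) = (M^*, N^*) (Θᵀ ⊗ H) (M^*, N^*)^*`, the adjoint of the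
generalized Lyapunov operator. -/
noncomputable def lyapAdj {ι κ : Type*} [Fintype ι] (M N : Matrix ι κ ℂ)
    (Θ : Matrix (Fin 2) (Fin 2) ℂ) (H : Matrix ι ι ℂ) : Matrix κ κ ℂ :=
  blockRow M.conjTranspose N.conjTranspose * (Θ.transpose ⊗ₖ H) *
    (blockRow M.conjTranspose N.conjTranspose).conjTranspose

/-- The matrix composed of the blocks `G i j`. -/
def blockMat {m k : ℕ} (G : Fin m → Fin m → Matrix (Fin k) (Fin k) ℂ) :
    Matrix (Fin m × Fin k) (Fin m × Fin k) ℂ :=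
  Matrix.of fun a b => G a.1 b.1 a.2 b.2

/-- The `m × m` matrix with entries `z^* G_{ij} z`. -/
def quadMat {m k : ℕ} (G : Fin m → Fin m → Matrix (Fin k) (Fin k) ℂ) (z : Fin k → ℂ) :
    Matrix (Fin m) (Fin m) ℂ :=
  Matrix.of fun i j => star z ⬝ᵥ Matrix.mulVec (G i j) z

/-- The inequalities `H₂ > 0` and
`G > Λ'_{I ⊗ M, I ⊗ N, Θ₁}(H₁) + Λ'_{I ⊗ M, I ⊗ N, Θ₂}(H₂)`, where `A > B` means that `A - B`
is positive definite. -/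
def SatisfiesLMI {m n k : ℕ} (G : Fin m → Fin m → Matrix (Fin k) (Fin k) ℂ)
    (M N : Matrix (Fin n) (Fin k) ℂ) (Θ₁ Θ₂ : Matrix (Fin 2) (Fin 2) ℂ)
    (H₁ H₂ : Matrix (Fin m × Fin n) (Fin m × Fin n) ℂ) : Prop :=
  H₂.PosDef ∧
    (blockMat G -
      (lyapAdj ((1 : Matrix (Fin m) (Fin m) ℂ) ⊗ₖ M) ((1 : Matrix (Fin m) (Fin m) ℂ) ⊗ₖ N) Θ₁ H₁ +
       lyapAdj ((1 : Matrix (Fin m) (Fin m) ℂ) ⊗ₖ M) ((1 : Matrix (Fin m) (Fin m) ℂ) ⊗ₖ N) Θ₂ H₂)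
      ).PosDef

/-! For fixed `p` the matter is convex duality. If the inequality has no solution, the convex set of
Hermitian matrices `G - Λ'(H₁) - Λ'(H₂)` misses the positive definite cone, so some `F ≠ 0` gives
`Re tr (F^* X F) ≤ 0` on it (`exists_re_trace_nonpos_of_forall_not_posDef`). As `H₁` is an arbitrary
Hermitian matrix and `H₂` ranges over a cone, the Lyapunov operator of `Θ₁` kills `F F^*`, that of
`Θ₂` maps it to a positive semidefinite matrix, and `Re tr (F^* G F) ≤ 0`.

Two points of `Γ ∩ Ω` give a basis of rows isotropic for `Θ₁`. In the corresponding coordinates `(A,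
B)` of `(M F, N F)` these conditions say that `A B^*` is Hermitian and that a real quadratic
expression in `A, B` is positive semidefinite. Then a unitary `U` diagonalizes the pair
(`jointlyDiagonalizable_of_quadratic`): each `F u`, with `u` a column of `U`, is annihilated by the
pencil at a point of `Γ ∩ Ω`. Since `tr (F^* G F)` is the sum of the values of `G` at the vectors `F
u`, positivity on such vectors gives a contradiction. For `m > 1` the kernel of the pencil is a
line, so kernel vectors of `I ⊗ (l N - M)` are elementary tensors. The converse evaluates the
inequality at a kernel vector.

For varying `p` the solution set is convex and a solution at one parameter persists nearby, so local
constant solutions are glued by a partition of unity. -/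

namespace Matrix

/-! ### Simultaneous diagonalization of a pair of rectangular matrices. -/

variable {ι κ : Type*} [Fintype κ]

/-- The columns of some unitary matrix `U` are generalized singular vectors of the pair `(A, B)`
with real homogeneous eigenvalues `(x, y)` satisfying `S`. -/
def JointlyDiagonalizable [DecidableEq κ] (A B : Matrix ι κ ℂ) (S : ℝ → ℝ → Prop) : Prop :=
  ∃ U : Matrix κ κ ℂ, U * Uᴴ = 1 ∧ ∀ k, ∃ (x y : ℝ) (w : ι → ℂ), (x ≠ 0 ∨ y ≠ 0) ∧ S x y ∧
    A *ᵥ U.col k = (x : ℂ) • w ∧ B *ᵥ U.col k = (y : ℂ) • w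

theorem JointlyDiagonalizable.mono [DecidableEq κ] {A B : Matrix ι κ ℂ} {S T : ℝ → ℝ → Prop}
    (h : JointlyDiagonalizable A B S) (hST : ∀ x y, S x y → T x y) :
    JointlyDiagonalizable A B T := by
  obtain ⟨U, hU, hk⟩ := h
  refine ⟨U, hU, fun k => ?_⟩
  obtain ⟨x, y, w, hxy, hs, hu⟩ := hk k
  exact ⟨x, y, w, hxy, hST _ _ hs, hu⟩

theorem JointlyDiagonalizable.of_neg_right [DecidableEq κ] {A B : Matrix ι κ ℂ}
    {S : ℝ → ℝ → Prop} (h : JointlyDiagonalizable A (-B) fun x y => S x (-y)) :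
    JointlyDiagonalizable A B S := by
  obtain ⟨U, hU, hk⟩ := h
  refine ⟨U, hU, fun k => ?_⟩
  obtain ⟨x, y, w, hxy, hs, hA, hB⟩ := hk k
  refine ⟨x, -y, w, by simpa using hxy, hs, hA, ?_⟩
  rw [neg_mulVec] at hB
  rw [← neg_neg (B *ᵥ _), hB]
  simp

variable [Fintype ι]

/-- Every Hermitian matrix has a Hermitian Moore-Penrose inverse. -/
theorem IsHermitian.exists_pseudoinverse {P : Matrix ι ι ℂ} (hP : P.IsHermitian) :
    ∃ Q : Matrix ι ι ℂ, Q.IsHermitian ∧ P * Q * P = P ∧ Q * P * Q = Q := by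
  classical
  have hmul (f g : ℝ → ℝ) : cfc f P * cfc g P = cfc (fun x => f x * g x) P :=
    (cfc_mul f g P ((finite_real_spectrum (A := P)).continuousOn _)
      ((finite_real_spectrum (A := P)).continuousOn _)).symm
  have hid : cfc (fun x : ℝ => x) P = P := cfc_id' ℝ P hP
  refine ⟨cfc (fun x : ℝ => x⁻¹) P, cfc_predicate _ P, ?_, ?_⟩
  · calc P * cfc (fun x : ℝ => x⁻¹) P * P
        = cfc (fun x : ℝ => x) P * cfc (fun x : ℝ => x⁻¹) P * cfc (fun x : ℝ => x) P := by rw [hid]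
      _ = P := by rw [hmul, hmul]; simp only [mul_inv_mul_cancel]; exact hid
  · calc cfc (fun x : ℝ => x⁻¹) P * P * cfc (fun x : ℝ => x⁻¹) P
        = cfc (fun x : ℝ => x⁻¹) P * cfc (fun x : ℝ => x) P * cfc (fun x : ℝ => x⁻¹) P := by
          rw [hid]
      _ = _ := by
        rw [hmul, hmul]
        congr 1
        ext x
        rcases eq_or_ne x 0 with rfl | hx
        · simp
        · field_simp

/-- Some shift of a Hermitian matrix is positive semidefinite. -/
theorem IsHermitian.exists_add_smul_one_posSemidef [DecidableEq ι] {Z : Matrix ι ι ℂ}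
    (hZ : Z.IsHermitian) : ∃ c : ℝ, (Z + (c : ℂ) • (1 : Matrix ι ι ℂ)).PosSemidef := by
  refine ⟨∑ i, |hZ.eigenvalues i|, ?_⟩
  have hs := hZ.spectral_theorem
  rw [Unitary.conjStarAlgAut_apply] at hs
  set U := hZ.eigenvectorUnitary
  have h1 : (1 : Matrix ι ι ℂ) = (U : Matrix ι ι ℂ) * 1 * star (U : Matrix ι ι ℂ) := by
    simp
  rw [h1]
  nth_rw 1 [hs]
  rw [← smul_mul_assoc, ← mul_smul_comm, ← add_mul, ← mul_add]
  refine PosSemidef.mul_mul_conjTranspose_same ?_ _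
  rw [← diagonal_one, ← diagonal_smul, diagonal_add, posSemidef_diagonal_iff]
  intro i
  have h := Finset.single_le_sum (f := fun i => |hZ.eigenvalues i|) (fun i _ => abs_nonneg _)
    (Finset.mem_univ i)
  have h2 : 0 ≤ hZ.eigenvalues i + ∑ i, |hZ.eigenvalues i| := by
    have := neg_abs_le (hZ.eigenvalues i)
    linarith
  have : (0 : ℂ) ≤ ((hZ.eigenvalues i + ∑ i, |hZ.eigenvalues i| : ℝ) : ℂ) := by exact_mod_cast h2
  simpa using this

/-- The equation `A = (A + B) K` has a Hermitian solution with `K² ≤ K`. An eigenvector `u` of `K`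
with eigenvalue `e ∈ [0, 1]` has `A u = e w` and `B u = (1 - e) w` for `w = (A + B) u`. -/
theorem jointlyDiagonalizable_of_posSemidef [DecidableEq κ] {A B : Matrix ι κ ℂ}
    (h : (A * Bᴴ).PosSemidef) :
    JointlyDiagonalizable A B fun x y => 0 ≤ x ∧ 0 ≤ y := by
  classical
  obtain ⟨Q, hQ, hPQP, hQPQ⟩ :=
    ((posSemidef_self_mul_conjTranspose A).add h).isHermitian.exists_pseudoinverse
  set P := A * Aᴴ + A * Bᴴ with hPdef
  have hP : Pᴴ = P := ((posSemidef_self_mul_conjTranspose A).add h).isHermitian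
  have hQ' : Qᴴ = Q := hQ
  -- `P Q` fixes the range of `P`, which contains that of `A` because `A A^* ≤ P`.
  have hPA : P * Q * A = A := by
    have hE : (P * Q - 1) * P = 0 := by rw [sub_mul, hPQP, one_mul, sub_self]
    have h1 := h.mul_mul_conjTranspose_same (P * Q - 1)
    have h2 : (P * Q - 1) * (A * Bᴴ) * (P * Q - 1)ᴴ
        = -(((P * Q - 1) * A) * ((P * Q - 1) * A)ᴴ) := by
      have : A * Bᴴ = P - A * Aᴴ := by rw [hPdef]; abel
      rw [this, mul_sub, hE, conjTranspose_mul]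
      simp only [Matrix.mul_assoc, zero_sub, neg_mul]
    rw [h2] at h1
    have h3 := posSemidef_self_mul_conjTranspose ((P * Q - 1) * A)
    have h4 : ((P * Q - 1) * A) * ((P * Q - 1) * A)ᴴ = 0 := by
      open scoped MatrixOrder in
      exact le_antisymm (by rw [← neg_nonneg]; exact nonneg_iff_posSemidef.2 h1)
        (nonneg_iff_posSemidef.2 h3)
    rw [self_mul_conjTranspose_eq_zero, Matrix.sub_mul, Matrix.one_mul, sub_eq_zero] at h4
    exact h4
  set K := Aᴴ * Q * A with hKdef
  have hK : K.IsHermitian := isHermitian_conjTranspose_mul_mul A hQ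
  have hAK : (A + B) * K = A := by
    have : (A + B) * Aᴴ = P := by
      rw [← hP, hPdef]; simp [Matrix.add_mul]
    rw [hKdef, ← Matrix.mul_assoc, ← Matrix.mul_assoc, this, hPA]
  -- `K - K²` is the congruence of `A B^* = P - A A^*` by `Q A`.
  have hKK : (K - K * K).PosSemidef := by
    have h1 := h.conjTranspose_mul_mul_same (Q * A)
    convert h1 using 1
    have : A * Bᴴ = P - A * Aᴴ := by rw [hPdef]; abel
    rw [this, conjTranspose_mul, hQ', Matrix.mul_sub, Matrix.sub_mul, hKdef]
    congr 1
    · nth_rw 1 [← hQPQ]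
      simp only [Matrix.mul_assoc]
    · simp only [Matrix.mul_assoc]
  refine ⟨hK.eigenvectorUnitary, ?_, fun k => ?_⟩
  · exact Unitary.mul_star_self_of_mem hK.eigenvectorUnitary.2
  set u : κ → ℂ := (hK.eigenvectorUnitary : Matrix κ κ ℂ).col k with hu
  set e := hK.eigenvalues k
  have hKu : K *ᵥ u = (e : ℂ) • u := by
    have := hK.mulVec_eigenvectorBasis k
    rw [← hK.eigenvectorUnitary_col_eq k] at this
    rw [this]; rfl
  have huu : star u ⬝ᵥ u = 1 := by
    have h1 : star (hK.eigenvectorUnitary : Matrix κ κ ℂ) * hK.eigenvectorUnitary = 1 :=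
      Unitary.star_mul_self_of_mem hK.eigenvectorUnitary.2
    have := congr_fun (congr_fun h1 k) k
    rw [one_apply_eq] at this
    rw [← this]; rfl
  have hee : 0 ≤ e - e * e := by
    have := hKK.dotProduct_mulVec_nonneg u
    rw [sub_mulVec, ← mulVec_mulVec u K K, hKu, mulVec_smul, hKu, smul_smul, ← sub_smul,
      dotProduct_smul, huu] at this
    have h2 : (0 : ℂ) ≤ ((e - e * e : ℝ) : ℂ) := by simpa using this
    exact_mod_cast h2
  have hAu : A *ᵥ u = (e : ℂ) • ((A + B) *ᵥ u) := by
    nth_rw 1 [← hAK]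
    rw [← mulVec_mulVec, hKu, mulVec_smul]
  have he : 0 ≤ e := by nlinarith
  refine ⟨e, 1 - e, (A + B) *ᵥ u, ?_, ⟨he, by nlinarith⟩, hAu, ?_⟩
  · by_contra! h0
    linarith [h0.1, h0.2]
  · push_cast
    rw [sub_smul, one_smul, ← hAu, add_mulVec]
    abel

/-- Replacing `B` by `B + c A` with large real `c` makes the product positive semidefinite, and the
shift only changes `y` by `c x`. -/
theorem jointlyDiagonalizable_of_isHermitian [DecidableEq κ] {A B : Matrix ι κ ℂ}
    (h : (A * Bᴴ).IsHermitian) :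
    JointlyDiagonalizable A B fun _ _ => True := by
  classical
  have h' : B * Aᴴ = A * Bᴴ := by
    have := h.eq
    rwa [conjTranspose_mul, conjTranspose_conjTranspose] at this
  obtain ⟨Q, hQ, hPQP, -⟩ := (isHermitian_mul_conjTranspose_self A).exists_pseudoinverse
  have hQ' : Qᴴ = Q := hQ
  have hA : A * Aᴴ * Q * A = A := by
    have h4 : (A * Aᴴ * Q * A - A) * (A * Aᴴ * Q * A - A)ᴴ = 0 := by
      have : (A * Aᴴ * Q * A - A) * Aᴴ = 0 := by
        rw [Matrix.sub_mul, Matrix.mul_assoc (A * Aᴴ * Q), hPQP, sub_self]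
      rw [conjTranspose_sub, Matrix.mul_sub, this, conjTranspose_mul, ← Matrix.mul_assoc, this]
      simp
    rw [self_mul_conjTranspose_eq_zero, sub_eq_zero] at h4
    exact h4
  have hA' : Aᴴ * Q * (A * Aᴴ) = Aᴴ := by
    have := congr_arg conjTranspose hA
    simpa only [conjTranspose_mul, conjTranspose_conjTranspose, hQ', Matrix.mul_assoc] using this
  -- A Hermitian `Z` with `A Z A^* = A B^*`, so that a scalar shift of `Z` becomes a shift of `B` by
  -- a multiple of `A`; `A^* Q` acts as the pseudoinverse of `A`.
  set Z := Aᴴ * (Q * (B * Aᴴ) * Q) * A with hZdef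
  have hZ : Z.IsHermitian := by
    refine isHermitian_conjTranspose_mul_mul A ?_
    have := isHermitian_conjTranspose_mul_mul Q (h'.symm ▸ h : (B * Aᴴ).IsHermitian)
    rwa [hQ'] at this
  have hAZ : A * Z * Aᴴ = A * Bᴴ := by
    calc A * Z * Aᴴ = A * Aᴴ * Q * (B * Aᴴ) * Q * (A * Aᴴ) := by
          simp only [hZdef, Matrix.mul_assoc]
      _ = (A * Aᴴ * Q * A) * Bᴴ * Q * (A * Aᴴ) := by rw [h']; simp only [Matrix.mul_assoc]
      _ = (B * Aᴴ) * Q * (A * Aᴴ) := by rw [hA, h']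
      _ = B * (Aᴴ * Q * (A * Aᴴ)) := by simp only [Matrix.mul_assoc]
      _ = A * Bᴴ := by rw [hA', h']
  obtain ⟨c, hc⟩ := hZ.exists_add_smul_one_posSemidef
  have hps : (A * (B + (c : ℂ) • A)ᴴ).PosSemidef := by
    have := hc.mul_mul_conjTranspose_same A
    convert this using 1
    rw [Matrix.mul_add, Matrix.add_mul, hAZ]
    simp [Matrix.mul_add]
  obtain ⟨U, hU, hk⟩ := jointlyDiagonalizable_of_posSemidef hps
  refine ⟨U, hU, fun k => ?_⟩
  obtain ⟨x, y, w, hxy, -, hAu, hBu⟩ := hk k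
  refine ⟨x, y - c * x, w, ?_, trivial, hAu, ?_⟩
  · by_contra! h0
    obtain ⟨rfl, h1⟩ := h0
    simp_all
  · rw [add_mulVec, smul_mulVec, hAu] at hBu
    rw [eq_sub_of_add_eq hBu]
    push_cast
    rw [sub_smul, smul_smul]

/-- A pair `(A, B)` with `A B^*` Hermitian that satisfies an indefinite quadratic inequality with
real coefficients is diagonalizable with eigenvalues satisfying the scalar inequality. -/
theorem jointlyDiagonalizable_of_quadratic_of_pos [DecidableEq κ] {A B : Matrix ι κ ℂ} {a g d : ℝ}
    (hg : 0 < g) (hadg : a * d < g ^ 2)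
    (h : (A * Bᴴ).IsHermitian)
    (hS : ((a : ℂ) • (A * Aᴴ) + ((2 * g : ℝ) : ℂ) • (A * Bᴴ) + (d : ℂ) • (B * Bᴴ)).PosSemidef) :
    JointlyDiagonalizable A B fun x y => 0 ≤ a * x ^ 2 + 2 * g * x * y + d * y ^ 2 := by
  have h' : B * Aᴴ = A * Bᴴ := by
    have := h.eq
    rwa [conjTranspose_mul, conjTranspose_conjTranspose] at this
  set s := Real.sqrt (g ^ 2 - a * d) with hs
  have hs0 : 0 < s := Real.sqrt_pos.2 (by linarith)
  have hss : s ^ 2 = g ^ 2 - a * d := Real.sq_sqrt (by linarith)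
  -- The larger root of `q² - 2 g q + a d = 0`. With it, `q` times the quadratic expression factors
  -- as `(a A + q B) (q A + d B)^*`, thanks to `B A^* = A B^*`.
  obtain ⟨q, hq⟩ : ∃ q, q = g + s := ⟨_, rfl⟩
  have hq0 : 0 < q := by linarith
  have hqq : a * d + q ^ 2 = 2 * g * q := by rw [hq]; linear_combination hss
  have hdet : a * d - q ^ 2 ≠ 0 := by
    have : a * d - q ^ 2 = - (2 * s * q) := by rw [hq]; linear_combination hss
    rw [this]
    exact neg_ne_zero.2 (by positivity)
  have hps : (((a : ℂ) • A + (q : ℂ) • B) * ((q : ℂ) • A + (d : ℂ) • B)ᴴ).PosSemidef := by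
    have := hS.smul (a := (q : ℂ)) (by exact_mod_cast hq0.le)
    convert this using 1
    have hqq' : (a : ℂ) * d + q * q = q * (2 * g) := by
      have : a * d + q * q = q * (2 * g) := by linarith
      exact_mod_cast this
    simp only [conjTranspose_add, conjTranspose_smul, Matrix.mul_add, Matrix.add_mul,
      Matrix.smul_mul, Matrix.mul_smul, h', smul_add, smul_smul, Complex.star_def, Complex.conj_ofReal,
      Complex.ofReal_mul, Complex.ofReal_ofNat]
    rw [← hqq', add_smul, mul_comm (d : ℂ) (q : ℂ), mul_comm (d : ℂ) (a : ℂ)]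
    abel
  obtain ⟨U, hU, hk⟩ := jointlyDiagonalizable_of_posSemidef hps
  refine ⟨U, hU, fun k => ?_⟩
  obtain ⟨x', y', w, hxy, ⟨hx, hy⟩, hA, hB⟩ := hk k
  -- Cramer's rule inverts the substitution `x' = a x + q y`, `y' = q x + d y`; the scalar form is
  -- then `x' y' / q`.
  obtain ⟨x, hxd⟩ : ∃ x, x = (d * x' - q * y') / (a * d - q ^ 2) := ⟨_, rfl⟩
  obtain ⟨y, hyd⟩ : ∃ y, y = (a * y' - q * x') / (a * d - q ^ 2) := ⟨_, rfl⟩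
  have hx1 : a * x + q * y = x' := by rw [hxd, hyd, mul_div_assoc', mul_div_assoc', ← add_div, div_eq_iff hdet]; ring
  have hy1 : q * x + d * y = y' := by rw [hxd, hyd, mul_div_assoc', mul_div_assoc', ← add_div, div_eq_iff hdet]; ring
  rw [add_mulVec, smul_mulVec, smul_mulVec] at hA hB
  have hdetC : ((a : ℂ) * d - q ^ 2) ≠ 0 := by exact_mod_cast hdet
  refine ⟨x, y, w, ?_, ?_, ?_, ?_⟩
  · by_contra! h0
    rw [h0.1, h0.2] at hx1 hy1
    simp at hx1 hy1
    rw [← hx1, ← hy1] at hxy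
    simp at hxy
  · have : 0 ≤ q * (a * x ^ 2 + 2 * g * x * y + d * y ^ 2) := by
      have : q * (a * x ^ 2 + 2 * g * x * y + d * y ^ 2) = x' * y' := by
        rw [← hx1, ← hy1]; linear_combination (-x * y) * hqq
      rw [this]; positivity
    exact nonneg_of_mul_nonneg_right this hq0
  · have : ((a : ℂ) * d - q ^ 2) • (A *ᵥ U.col k) = ((a : ℂ) * d - q ^ 2) • ((x : ℂ) • w) := by
      calc ((a : ℂ) * d - q ^ 2) • (A *ᵥ U.col k)
          = (d : ℂ) • ((a : ℂ) • A *ᵥ U.col k + (q : ℂ) • B *ᵥ U.col k)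
            - (q : ℂ) • ((q : ℂ) • A *ᵥ U.col k + (d : ℂ) • B *ᵥ U.col k) := by module
        _ = _ := by
          rw [hA, hB, smul_smul, smul_smul, smul_smul, ← sub_smul, hxd]
          push_cast
          rw [mul_div_cancel₀ _ hdetC]
    exact smul_right_injective _ hdetC this
  · have : ((a : ℂ) * d - q ^ 2) • (B *ᵥ U.col k) = ((a : ℂ) * d - q ^ 2) • ((y : ℂ) • w) := by
      calc ((a : ℂ) * d - q ^ 2) • (B *ᵥ U.col k)
          = (a : ℂ) • ((q : ℂ) • A *ᵥ U.col k + (d : ℂ) • B *ᵥ U.col k)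
            - (q : ℂ) • ((a : ℂ) • A *ᵥ U.col k + (q : ℂ) • B *ᵥ U.col k) := by module
        _ = _ := by
          rw [hA, hB, smul_smul, smul_smul, smul_smul, ← sub_smul, hyd]
          push_cast
          rw [mul_div_cancel₀ _ hdetC]
    exact smul_right_injective _ hdetC this

/-- If `g² ≤ a d`, the scalar inequality holds for all real `x, y`. Otherwise `a d ≥ 0` forces `g ≠
0`, and the sign of `g` is corrected by `B ↦ -B`. -/
theorem jointlyDiagonalizable_of_quadratic [DecidableEq κ] {A B : Matrix ι κ ℂ} {a g d : ℝ}
    (ha : 0 ≤ a) (hd : 0 ≤ d) (h : (A * Bᴴ).IsHermitian)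
    (hS : ((a : ℂ) • (A * Aᴴ) + ((2 * g : ℝ) : ℂ) • (A * Bᴴ) + (d : ℂ) • (B * Bᴴ)).PosSemidef) :
    JointlyDiagonalizable A B fun x y => 0 ≤ a * x ^ 2 + 2 * g * x * y + d * y ^ 2 := by
  rcases le_or_gt (g ^ 2) (a * d) with hg | hg
  · refine (jointlyDiagonalizable_of_isHermitian h).mono fun x y _ => ?_
    rcases ha.eq_or_lt with rfl | ha
    · have : g = 0 := by nlinarith
      subst this
      simp; positivity
    · have : 0 ≤ a * (a * x ^ 2 + 2 * g * x * y + d * y ^ 2) := by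
        nlinarith [sq_nonneg (a * x + g * y), mul_nonneg (sub_nonneg.2 hg) (sq_nonneg y)]
      exact nonneg_of_mul_nonneg_right this ha
  · rcases lt_trichotomy g 0 with h0 | rfl | h0
    · refine JointlyDiagonalizable.of_neg_right ?_
      refine (jointlyDiagonalizable_of_quadratic_of_pos (a := a) (g := -g) (d := d) (by linarith)
        (by simpa using hg) ?_ ?_).mono fun x y hxy => ?_
      · simpa using h.neg
      · convert hS using 1
        simp
      · linarith
    · nlinarith [mul_nonneg ha hd]
    · exact jointlyDiagonalizable_of_quadratic_of_pos h0 hg h hS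

end Matrix

/-! ### Separation from the positive definite cone. -/

namespace Matrix

variable {ι κ : Type*} [Fintype ι] [Fintype κ]

/-- The set of parameters at which a continuous matrix function has positive real quadratic form
is open. -/
theorem isOpen_setOf_re_quadratic_pos {Y : Type*} [TopologicalSpace Y] {X : Y → Matrix κ κ ℂ}
    (hX : Continuous X) :
    IsOpen {y | ∀ x : κ → ℂ, x ≠ 0 → 0 < (star x ⬝ᵥ X y *ᵥ x).re} := by
  -- By homogeneity the unit sphere suffices, and its compactness makes positivity an open
  -- condition.
  have h1 : {y | ∀ x : κ → ℂ, x ≠ 0 → 0 < (star x ⬝ᵥ X y *ᵥ x).re} =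
      {y | ∀ x ∈ Metric.sphere (0 : κ → ℂ) 1, 0 < (star x ⬝ᵥ X y *ᵥ x).re} := by
    ext y
    refine ⟨fun h x hx => h x ?_, fun h x hx => ?_⟩
    · rintro rfl
      simp at hx
    · have hn : ‖x‖ ≠ 0 := norm_ne_zero_iff.2 hx
      have := h (((‖x‖⁻¹ : ℝ) : ℂ) • x) (by simp [norm_smul, hn])
      rw [mulVec_smul, dotProduct_smul, star_smul, smul_dotProduct] at this
      simp only [Complex.star_def, Complex.conj_ofReal, smul_eq_mul, Complex.re_ofReal_mul] at this
      have hp : 0 < ‖x‖⁻¹ := by positivity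
      exact pos_of_mul_pos_right (pos_of_mul_pos_right this hp.le) hp.le
  rw [h1, isOpen_iff_eventually]
  intro y hy
  refine (isCompact_sphere (0 : κ → ℂ) 1).eventually_forall_of_forall_eventually fun x hx => ?_
  have hc : Continuous fun z : Y × (κ → ℂ) => (star z.2 ⬝ᵥ X z.1 *ᵥ z.2).re := by
    refine Complex.continuous_re.comp ?_
    exact (continuous_star.comp continuous_snd).dotProduct
      ((hX.comp continuous_fst).matrix_mulVec continuous_snd)
  exact hc.continuousAt.eventually (lt_mem_nhds (hy x hx))

theorem IsHermitian.posDef_iff_re_quadratic_pos {X : Matrix κ κ ℂ} (hX : X.IsHermitian) :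
    X.PosDef ↔ ∀ x : κ → ℂ, x ≠ 0 → 0 < (star x ⬝ᵥ X *ᵥ x).re := by
  refine ⟨fun h x hx => h.re_dotProduct_pos hx, fun h => ?_⟩
  refine PosDef.of_dotProduct_mulVec_pos hX fun x hx => ?_
  have := hX.im_star_dotProduct_mulVec_self x
  exact Complex.pos_iff.2 ⟨h x hx, this.symm⟩

/-- A convex set of Hermitian matrices without positive definite elements is separated from the
positive definite cone by a functional `X ↦ tr (F^* X F)`. -/
theorem exists_re_trace_nonpos_of_forall_not_posDef {C : Set (Matrix κ κ ℂ)} (hC : Convex ℝ C)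
    (hne : C.Nonempty) (hherm : ∀ X ∈ C, X.IsHermitian) (hpos : ∀ X ∈ C, ¬ X.PosDef) :
    ∃ F : Matrix κ κ ℂ, F ≠ 0 ∧ ∀ X ∈ C, (trace (Fᴴ * X * F)).re ≤ 0 := by
  classical
  -- Non-Hermitian matrices are admitted so that the cone is open in the whole matrix space.
  set P : Set (Matrix κ κ ℂ) := {X | ∀ x : κ → ℂ, x ≠ 0 → 0 < (star x ⬝ᵥ X *ᵥ x).re} with hPdef
  have hPo : IsOpen P := isOpen_setOf_re_quadratic_pos continuous_id
  have hquad (X Y : Matrix κ κ ℂ) (a b : ℝ) (x : κ → ℂ) :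
      (star x ⬝ᵥ (a • X + b • Y) *ᵥ x).re =
        a * (star x ⬝ᵥ X *ᵥ x).re + b * (star x ⬝ᵥ Y *ᵥ x).re := by
    simp [add_mulVec, smul_mulVec, dotProduct_add, dotProduct_smul]
  have hPc : Convex ℝ P := by
    intro X hX Y hY a b ha hb hab x hx
    rw [hquad]
    rcases ha.eq_or_lt with rfl | ha
    · obtain rfl : b = 1 := by linarith
      simpa using hY x hx
    · have h1 := mul_pos ha (hX x hx)
      have h2 := mul_nonneg hb (hY x hx).le
      linarith
  obtain ⟨f, u, hfP, hfC⟩ := geometric_hahn_banach_open hPc hPo hC (by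
    rw [Set.disjoint_left]
    intro X hXP hXC
    exact hpos X hXC ((hherm X hXC).posDef_iff_re_quadratic_pos.2 hXP))
  have hPone : (1 : Matrix κ κ ℂ) ∈ P :=
    (isHermitian_one.posDef_iff_re_quadratic_pos).1 PosDef.one
  have hPadd {X Y : Matrix κ κ ℂ} (hX : X ∈ P) {s : ℝ} (hs : 0 < s)
      (hY : ∀ x : κ → ℂ, 0 ≤ (star x ⬝ᵥ Y *ᵥ x).re) {t : ℝ} (ht : 0 ≤ t) : s • X + t • Y ∈ P := by
    intro x hx
    rw [hquad]
    have := mul_pos hs (hX x hx)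
    have := mul_nonneg ht (hY x)
    linarith
  have hnonpos {Y : Matrix κ κ ℂ} (hY : ∀ x : κ → ℂ, 0 ≤ (star x ⬝ᵥ Y *ᵥ x).re) : f Y ≤ 0 := by
    by_contra! h
    have h1 := hfP _ (hPadd hPone one_pos hY
      (t := (|u - f 1|) / f Y) (by positivity))
    rw [map_add, map_smul, map_smul, smul_eq_mul, smul_eq_mul, div_mul_cancel₀ _ h.ne'] at h1
    linarith [le_abs_self (u - f 1)]
  have hu : 0 ≤ u := by
    by_contra! h
    have h1 := hfP 1 hPone
    have h2 := hfP _ (hPadd hPone (s := u / f 1) (div_pos_of_neg_of_neg h (h1.trans h))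
      (Y := 0) (by simp) le_rfl)
    rw [smul_zero, add_zero, map_smul, smul_eq_mul, div_mul_cancel₀ _ (h1.trans h).ne] at h2
    exact lt_irrefl _ h2
  -- The quadratic form of a skew-Hermitian matrix is purely imaginary, so `S` and `-S` both fall
  -- under `hnonpos`.
  have hskew {S : Matrix κ κ ℂ} (hS : Sᴴ = -S) : f S = 0 := by
    have h0 (x : κ → ℂ) : (star x ⬝ᵥ S *ᵥ x).re = 0 := by
      have h1 : star (star x ⬝ᵥ S *ᵥ x) = - (star x ⬝ᵥ S *ᵥ x) := by
        rw [← star_dotProduct_star, star_star, star_mulVec, hS, vecMul_neg, neg_dotProduct,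
          ← dotProduct_mulVec]
      have := congr_arg Complex.re h1
      simp at this
      linarith
    refine le_antisymm (hnonpos fun x => (h0 x).ge) ?_
    have := hnonpos (Y := -S) fun x => by simp [neg_mulVec, h0 x]
    simpa using this
  -- The complex-linear extension of `-f` is represented by a trace against `W`. Vanishing of `f` on
  -- skew-Hermitian matrices makes `W` Hermitian, and its sign on dyads makes `W` positive
  -- semidefinite.
  set φ : Matrix κ κ ℂ →ₗ[ℂ] ℂ := Module.Dual.extendRCLike (𝕜 := ℂ) (-f : Matrix κ κ ℂ →L[ℝ] ℝ).toLinearMap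
    with hφdef
  have hφ (X : Matrix κ κ ℂ) : φ X = -(f X : ℂ) + Complex.I * f (Complex.I • X) := by
    rw [hφdef, Module.Dual.extendRCLike_apply]
    simp
  set W : Matrix κ κ ℂ := of fun j i => φ (single i j 1) with hWdef
  have hW (X : Matrix κ κ ℂ) : trace (W * X) = φ X := by
    nth_rw 2 [matrix_eq_sum_single X]
    simp only [trace, diag_apply, mul_apply, map_sum]
    rw [Finset.sum_comm]
    refine Finset.sum_congr rfl fun i _ => Finset.sum_congr rfl fun j _ => ?_
    have : single i j (X i j) = X i j • single i j (1 : ℂ) := by simp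
    rw [this, map_smul, hWdef, of_apply, smul_eq_mul, mul_comm]
  have hWH : W.IsHermitian := by
    ext j i
    rw [conjTranspose_apply, hWdef, of_apply, of_apply, hφ, hφ]
    have h1 : f (single i j 1) = f (single j i 1) := by
      have := hskew (S := single i j (1 : ℂ) - single j i 1) (by simp)
      rwa [map_sub, sub_eq_zero] at this
    have h2 : f (Complex.I • single i j 1) = - f (Complex.I • single j i 1) := by
      have := hskew (S := Complex.I • single i j (1 : ℂ) + Complex.I • single j i 1) (by
        simp [conjTranspose_single, ← single_neg, add_comm])
      rwa [map_add, add_eq_zero_iff_eq_neg] at this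
    rw [h1, h2]
    simp
  have hWP : W.PosSemidef := by
    refine PosSemidef.of_dotProduct_mulVec_nonneg hWH fun x => ?_
    have h1 : star x ⬝ᵥ W *ᵥ x = φ (vecMulVec x (star x)) := by
      rw [← hW, mul_vecMulVec, trace_vecMulVec, dotProduct_comm]
    have hP := posSemidef_vecMulVec_self_star x
    rw [h1, hφ, hskew (S := Complex.I • vecMulVec x (star x))]
    · have := hnonpos (Y := vecMulVec x (star x)) fun y => hP.re_dotProduct_nonneg y
      have h3 : (0 : ℂ) ≤ ((-f (vecMulVec x (star x)) : ℝ) : ℂ) := by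
        exact_mod_cast neg_nonneg.2 this
      simpa using h3
    · rw [conjTranspose_smul, hP.isHermitian.eq]; simp
  obtain ⟨F, hF⟩ : ∃ F : Matrix κ κ ℂ, W = Fᴴ * F := by
    open scoped MatrixOrder in
    exact CStarAlgebra.nonneg_iff_eq_star_mul_self.1 (nonneg_iff_posSemidef.2 hWP)
  have htr {X : Matrix κ κ ℂ} : (trace (Fᴴᴴ * X * Fᴴ)).re = - f X := by
    rw [conjTranspose_conjTranspose, Matrix.trace_mul_comm, ← Matrix.mul_assoc, ← hF, hW, hφ]
    simp
  refine ⟨Fᴴ, ?_, fun X hX => ?_⟩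
  · intro h0
    obtain ⟨X, hX⟩ := hne
    have h1 := htr (X := X)
    have h2 := htr (X := 1)
    rw [h0] at h1 h2
    have h3 := hfP 1 hPone
    have h4 := hfC X hX
    simp at h1 h2
    linarith
  · rw [htr]
    linarith [hfC X hX]

end Matrix

open Matrix

/-! ### Isotropic rows of a Hermitian form on `ℂ²`. -/

section Sesquilinear

/-- The sesquilinear form `(h, k) ↦ h Θ k^*` on row vectors. -/
def rowForm (Θ : Matrix (Fin 2) (Fin 2) ℂ) (h k : Fin 2 → ℂ) : ℂ :=
  Matrix.vecMul h Θ ⬝ᵥ star k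

variable {Θ : Matrix (Fin 2) (Fin 2) ℂ}

theorem rowForm_eq (Θ : Matrix (Fin 2) (Fin 2) ℂ) (h k : Fin 2 → ℂ) :
    rowForm Θ h k = (h 0 * Θ 0 0 + h 1 * Θ 1 0) * star (k 0) +
      (h 0 * Θ 0 1 + h 1 * Θ 1 1) * star (k 1) := by
  simp [rowForm, vecMul, dotProduct, Fin.sum_univ_two]

theorem star_rowForm (hΘ : Θ.IsHermitian) (h k : Fin 2 → ℂ) :
    star (rowForm Θ h k) = rowForm Θ k h := by
  have h00 := hΘ.apply 0 0
  have h01 := hΘ.apply 0 1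
  have h10 := hΘ.apply 1 0
  have h11 := hΘ.apply 1 1
  simp only [rowForm_eq, star_add, star_mul', star_star, h00, h01, h10, h11]
  ring

theorem rowForm_smul_add_smul (a b : ℂ) (f r : Fin 2 → ℂ) :
    rowForm Θ (a • f + b • r) (a • f + b • r) =
      a * star a * rowForm Θ f f + a * star b * rowForm Θ f r + b * star a * rowForm Θ r f +
        b * star b * rowForm Θ r r := by
  simp only [rowForm_eq, Pi.add_apply, Pi.smul_apply, smul_eq_mul, star_add, star_mul']
  ring

/-- The Gram matrix of two rows is `S Θ S^*`, where `S` has these rows; take determinants. -/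
theorem rowForm_mul_sub_mul (f r : Fin 2 → ℂ) :
    rowForm Θ f f * rowForm Θ r r - rowForm Θ f r * rowForm Θ r f =
      Θ.det * ((f 0 * r 1 - f 1 * r 0) * star (f 0 * r 1 - f 1 * r 0)) := by
  simp only [rowForm_eq, det_fin_two, star_sub, star_mul']
  ring

theorem homCoord_cross_ne_zero {l l' : OnePoint ℂ} (h : l ≠ l') :
    homCoord l 0 * homCoord l' 1 - homCoord l 1 * homCoord l' 0 ≠ 0 := by
  induction l using OnePoint.rec with
  | infty =>
    induction l' using OnePoint.rec with
    | infty => exact absurd rfl h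
    | coe c' => simp [homCoord]
  | coe c =>
    induction l' using OnePoint.rec with
    | infty => simp [homCoord]
    | coe c' =>
      have : c ≠ c' := fun hc => h (by rw [hc])
      simpa [homCoord, sub_eq_zero] using this

/-- Every nonzero row vector is proportional to the homogeneous coordinates of a point. -/
theorem exists_homCoord_eq_smul {h : Fin 2 → ℂ} (hh : h ≠ 0) :
    ∃ (l : OnePoint ℂ) (t : ℂ), homCoord l = t • h := by
  by_cases h1 : h 1 = 0
  · have h0 : h 0 ≠ 0 := by
      intro h0
      exact hh (by ext i; fin_cases i <;> simp [h0, h1])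
    refine ⟨OnePoint.infty, (h 0)⁻¹, ?_⟩
    ext i; fin_cases i <;> simp [homCoord, h0, h1]
  · refine ⟨((h 0 / h 1 : ℂ) : OnePoint ℂ), (h 1)⁻¹, ?_⟩
    ext i; fin_cases i <;> simp [homCoord, h1, div_eq_inv_mul]

/-- A basis of isotropic vectors of `Θ₁`, normalized so that `Θ₁` becomes the imaginary part and
consisting of vectors on which `Θ₂` is nonnegative. -/
theorem exists_isotropic_basis {Θ₁ Θ₂ : Matrix (Fin 2) (Fin 2) ℂ} (hΘ₁ : Θ₁.IsHermitian)
    (hdet : Θ₁.det ≠ 0) (hne : (thetaCurve Θ₁ ∩ thetaDomain Θ₂).Nontrivial) :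
    ∃ f r : Fin 2 → ℂ, f 0 * r 1 - f 1 * r 0 ≠ 0 ∧ rowForm Θ₁ f f = 0 ∧ rowForm Θ₁ r r = 0 ∧
      rowForm Θ₁ f r = -Complex.I ∧ rowForm Θ₁ r f = Complex.I ∧
      0 ≤ rowForm Θ₂ f f ∧ 0 ≤ rowForm Θ₂ r r := by
  obtain ⟨l, ⟨hl1, hl2⟩, l', ⟨hl'1, hl'2⟩, hll'⟩ := hne
  set p := homCoord l
  set r := homCoord l'
  have hc : p 0 * r 1 - p 1 * r 0 ≠ 0 := homCoord_cross_ne_zero hll'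
  replace hl1 : rowForm Θ₁ p p = 0 := hl1
  replace hl'1 : rowForm Θ₁ r r = 0 := hl'1
  replace hl2 : 0 ≤ rowForm Θ₂ p p := hl2
  have hβ : rowForm Θ₁ p r ≠ 0 := by
    intro h0
    have := rowForm_mul_sub_mul (Θ := Θ₁) p r
    rw [hl1, h0, zero_mul, zero_mul, sub_zero] at this
    exact mul_ne_zero hdet (mul_ne_zero hc (star_ne_zero.2 hc)) this.symm
  have hsmul (Θ : Matrix (Fin 2) (Fin 2) ℂ) (t : ℂ) (h k : Fin 2 → ℂ) :
      rowForm Θ (t • h) k = t * rowForm Θ h k := by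
    simp only [rowForm_eq, Pi.smul_apply, smul_eq_mul]; ring
  have hsmul' (Θ : Matrix (Fin 2) (Fin 2) ℂ) (t : ℂ) (h k : Fin 2 → ℂ) :
      rowForm Θ h (t • k) = star t * rowForm Θ h k := by
    simp only [rowForm_eq, Pi.smul_apply, smul_eq_mul, star_mul']; ring
  -- Scaling `p` by `t` turns the off-diagonal value into `1 / i = -i`.
  set t := (Complex.I * rowForm Θ₁ p r)⁻¹ with ht
  have ht0 : t ≠ 0 := inv_ne_zero (mul_ne_zero Complex.I_ne_zero hβ)
  have hfr : rowForm Θ₁ (t • p) r = -Complex.I := by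
    rw [hsmul, ht, mul_inv, mul_assoc, inv_mul_cancel₀ hβ, mul_one, Complex.inv_I]
  refine ⟨t • p, r, ?_, ?_, hl'1, hfr, ?_, ?_, hl'2⟩
  · have : (t • p) 0 * r 1 - (t • p) 1 * r 0 = t * (p 0 * r 1 - p 1 * r 0) := by
      simp only [Pi.smul_apply, smul_eq_mul]; ring
    rw [this]
    exact mul_ne_zero ht0 hc
  · rw [hsmul, hsmul', hl1, mul_zero, mul_zero]
  · rw [← star_rowForm hΘ₁, hfr]; simp
  · rw [hsmul, hsmul', ← mul_assoc]
    exact mul_nonneg (mul_star_self_nonneg t) hl2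

end Sesquilinear

/-! ### The generalized Lyapunov operator and its adjoint. -/

section Adjoint

variable {ι κ : Type*} [Fintype ι]

theorem lyapAdj_eq (M N : Matrix ι κ ℂ) (Θ : Matrix (Fin 2) (Fin 2) ℂ) (H : Matrix ι ι ℂ) :
    lyapAdj M N Θ H = Θ 0 0 • (Mᴴ * H * M) + Θ 1 0 • (Mᴴ * H * N) + Θ 0 1 • (Nᴴ * H * M) +
      Θ 1 1 • (Nᴴ * H * N) := by
  ext i j
  simp only [lyapAdj, blockRow, mul_apply, Fintype.sum_prod_type, Fin.sum_univ_two, of_apply,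
    kronecker_apply, conjTranspose_apply, transpose_apply, Matrix.add_apply, Matrix.smul_apply,
    smul_eq_mul, Finset.mul_sum, Finset.sum_mul, ← Finset.sum_add_distrib, cons_val_zero,
    cons_val_one, star_star]
  refine Finset.sum_congr rfl fun a _ => ?_
  refine Finset.sum_congr rfl fun b _ => ?_
  ring

theorem isHermitian_lyapAdj (M N : Matrix ι κ ℂ) {Θ : Matrix (Fin 2) (Fin 2) ℂ}
    (hΘ : Θ.IsHermitian) {H : Matrix ι ι ℂ} (hH : H.IsHermitian) :
    (lyapAdj M N Θ H).IsHermitian := by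
  have h00 := hΘ.apply 0 0
  have h01 := hΘ.apply 0 1
  have h10 := hΘ.apply 1 0
  have h11 := hΘ.apply 1 1
  simp only [IsHermitian, lyapAdj_eq, conjTranspose_add, conjTranspose_smul, conjTranspose_mul,
    conjTranspose_conjTranspose, h00, h01, h10, h11, hH.eq, Matrix.mul_assoc]
  abel

theorem lyapAdj_smul_add_smul (M N : Matrix ι κ ℂ) (Θ : Matrix (Fin 2) (Fin 2) ℂ)
    (H K : Matrix ι ι ℂ) (a b : ℝ) :
    lyapAdj M N Θ (a • H + b • K) = a • lyapAdj M N Θ H + b • lyapAdj M N Θ K := by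
  simp only [lyapAdj_eq, Matrix.mul_add, Matrix.add_mul, Matrix.mul_smul, Matrix.smul_mul,
    smul_add, smul_comm a, smul_comm b]
  abel

end Adjoint

section Gram

variable {ι κ : Type*} [Fintype κ]

/-- The generalized Lyapunov operator, evaluated at the Gram matrices of the pair `(A, B)`. -/
def lyapGram (A B : Matrix ι κ ℂ) (Θ : Matrix (Fin 2) (Fin 2) ℂ) : Matrix ι ι ℂ :=
  Θ 0 0 • (A * Aᴴ) + Θ 1 0 • (B * Aᴴ) + Θ 0 1 • (A * Bᴴ) + Θ 1 1 • (B * Bᴴ)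

/-- A change of basis in the pair replaces `Θ` by its Gram matrix on `f, r`. -/
theorem lyapGram_smul_add_smul (A B : Matrix ι κ ℂ) (Θ : Matrix (Fin 2) (Fin 2) ℂ)
    (f r : Fin 2 → ℂ) :
    lyapGram (f 0 • A + r 0 • B) (f 1 • A + r 1 • B) Θ =
      rowForm Θ f f • (A * Aᴴ) + rowForm Θ f r • (A * Bᴴ) + rowForm Θ r f • (B * Aᴴ) +
        rowForm Θ r r • (B * Bᴴ) := by
  simp only [lyapGram, rowForm_eq, conjTranspose_add, conjTranspose_smul, Matrix.mul_add,
    Matrix.add_mul, Matrix.mul_smul, Matrix.smul_mul]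
  module

theorem isHermitian_lyapGram (A B : Matrix ι κ ℂ) {Θ : Matrix (Fin 2) (Fin 2) ℂ}
    (hΘ : Θ.IsHermitian) : (lyapGram A B Θ).IsHermitian := by
  have h00 := hΘ.apply 0 0
  have h01 := hΘ.apply 0 1
  have h10 := hΘ.apply 1 0
  have h11 := hΘ.apply 1 1
  simp only [IsHermitian, lyapGram, conjTranspose_add, conjTranspose_smul, conjTranspose_mul,
    conjTranspose_conjTranspose, h00, h01, h10, h11]
  abel

end Gram

/-! ### Duality for a single pencil. -/

section Lyapunov

variable {ι κ : Type*} [Fintype ι] [Fintype κ]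

/-- Cyclicity of the trace. It turns inequalities valid for all `H` into conditions on one matrix.
-/
theorem trace_lyapAdj (M N : Matrix ι κ ℂ) (F : Matrix κ κ ℂ) (Θ : Matrix (Fin 2) (Fin 2) ℂ)
    (H : Matrix ι ι ℂ) :
    trace (Fᴴ * lyapAdj M N Θ H * F) = trace (H * lyapGram (M * F) (N * F) Θ) := by
  have h (X Y : Matrix ι κ ℂ) :
      trace (Fᴴ * (Xᴴ * H * Y) * F) = trace (H * ((Y * F) * (X * F)ᴴ)) := by
    rw [conjTranspose_mul, ← Matrix.mul_assoc H, Matrix.trace_mul_comm (H * (Y * F))]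
    simp only [Matrix.mul_assoc]
  simp only [lyapAdj_eq, lyapGram, Matrix.mul_add, Matrix.add_mul, Matrix.mul_smul,
    Matrix.smul_mul, trace_add, trace_smul, h]

/-- If the Gram matrix `F F^*` is annihilated by the first generalized Lyapunov operator and
mapped to a positive semidefinite matrix by the second one, then it is a sum of dyads of
generalized eigenvectors. -/
theorem exists_unitary_pencil_mulVec_eq_zero [DecidableEq κ] {M N : Matrix ι κ ℂ}
    {F : Matrix κ κ ℂ} {Θ₁ Θ₂ : Matrix (Fin 2) (Fin 2) ℂ} (hΘ₁ : Θ₁.IsHermitian)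
    (hΘ₂ : Θ₂.IsHermitian) (hdet : Θ₁.det ≠ 0)
    (hne : (thetaCurve Θ₁ ∩ thetaDomain Θ₂).Nontrivial)
    (h₁ : lyapGram (M * F) (N * F) Θ₁ = 0) (h₂ : (lyapGram (M * F) (N * F) Θ₂).PosSemidef) :
    ∃ U : Matrix κ κ ℂ, U * Uᴴ = 1 ∧ ∀ k, ∃ l ∈ thetaCurve Θ₁ ∩ thetaDomain Θ₂,
      pencil M N l *ᵥ (F *ᵥ U.col k) = 0 := by
  obtain ⟨f, r, hc, hff, hrr, hfr, hrf, hff2, hrr2⟩ := exists_isotropic_basis hΘ₁ hdet hne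
  set Δ := f 0 * r 1 - f 1 * r 0 with hΔ
  -- `A` and `B` are the coordinates of the pair `(M F, N F)` in the basis `f, r`, by Cramer's rule.
  obtain ⟨A, hA⟩ : ∃ A, A = Δ⁻¹ • (r 1 • (M * F) - r 0 • (N * F)) := ⟨_, rfl⟩
  obtain ⟨B, hB⟩ : ∃ B, B = Δ⁻¹ • (f 0 • (N * F) - f 1 • (M * F)) := ⟨_, rfl⟩
  have hMF : M * F = f 0 • A + r 0 • B := by
    have : f 0 • A + r 0 • B = (Δ⁻¹ * Δ) • (M * F) := by rw [hA, hB, hΔ]; module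
    rw [this, inv_mul_cancel₀ hc, one_smul]
  have hNF : N * F = f 1 • A + r 1 • B := by
    have : f 1 • A + r 1 • B = (Δ⁻¹ * Δ) • (N * F) := by rw [hA, hB, hΔ]; module
    rw [this, inv_mul_cancel₀ hc, one_smul]
  rw [hMF, hNF, lyapGram_smul_add_smul] at h₁ h₂
  have hAB : B * Aᴴ = A * Bᴴ := by
    rw [hff, hrr, hfr, hrf, zero_smul, zero_smul, zero_add, add_zero, neg_smul,
      neg_add_eq_zero] at h₁
    exact (smul_right_injective _ Complex.I_ne_zero h₁).symm
  have hABH : (A * Bᴴ).IsHermitian := by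
    rw [IsHermitian, conjTranspose_mul, conjTranspose_conjTranspose, hAB]
  obtain ⟨a, ha⟩ : ∃ a : ℝ, (a : ℂ) = rowForm Θ₂ f f :=
    ⟨_, (Complex.eq_re_of_ofReal_le hff2).symm⟩
  obtain ⟨d, hd⟩ : ∃ d : ℝ, (d : ℂ) = rowForm Θ₂ r r :=
    ⟨_, (Complex.eq_re_of_ofReal_le hrr2).symm⟩
  obtain ⟨g, hg⟩ : ∃ g : ℝ, ((2 * g : ℝ) : ℂ) = rowForm Θ₂ f r + rowForm Θ₂ r f := by
    refine ⟨(rowForm Θ₂ f r).re, ?_⟩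
    rw [← star_rowForm hΘ₂ f r, Complex.star_def, Complex.add_conj]
  rw [← ha] at hff2
  rw [← hd] at hrr2
  rw [hAB, add_assoc (rowForm Θ₂ f f • _), ← add_smul, ← hg, ← ha, ← hd] at h₂
  obtain ⟨U, hU, hk⟩ := jointlyDiagonalizable_of_quadratic (by exact_mod_cast hff2)
    (by exact_mod_cast hrr2) hABH h₂
  refine ⟨U, hU, fun k => ?_⟩
  obtain ⟨x, y, w, hxy, hq, hAu, hBu⟩ := hk k
  -- The point sought has homogeneous coordinates proportional to `x f + y r`. As `x, y` are real,
  -- the cross terms of `Θ₁` cancel, and `Θ₂` takes the value of the scalar quadratic form.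
  set h : Fin 2 → ℂ := (x : ℂ) • f + (y : ℂ) • r with hh
  have hh0 : h ≠ 0 := by
    intro h0
    have e0 := congr_fun h0 0
    have e1 := congr_fun h0 1
    simp only [hh, Pi.add_apply, Pi.smul_apply, smul_eq_mul, Pi.zero_apply] at e0 e1
    have hx : (x : ℂ) * Δ = 0 := by rw [hΔ]; linear_combination r 1 * e0 - r 0 * e1
    have hy : (y : ℂ) * Δ = 0 := by rw [hΔ]; linear_combination f 0 * e1 - f 1 * e0
    simp only [mul_eq_zero, hc, or_false, Complex.ofReal_eq_zero] at hx hy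
    simp [hx, hy] at hxy
  obtain ⟨l, t, hl⟩ := exists_homCoord_eq_smul hh0
  have hform (Θ : Matrix (Fin 2) (Fin 2) ℂ) :
      thetaForm Θ l = t * star t * rowForm Θ h h := by
    have : thetaForm Θ l = rowForm Θ (homCoord l) (homCoord l) := rfl
    rw [this, hl]
    simp only [rowForm_eq, Pi.smul_apply, smul_eq_mul, star_mul']
    ring
  refine ⟨l, ⟨?_, ?_⟩, ?_⟩
  · rw [thetaCurve, Set.mem_ofPred_eq, hform, hh, rowForm_smul_add_smul, hff, hrr, hfr, hrf]
    simp only [Complex.star_def, Complex.conj_ofReal]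
    ring
  · rw [thetaDomain, Set.mem_ofPred_eq, hform]
    refine mul_nonneg (mul_star_self_nonneg t) ?_
    have : rowForm Θ₂ h h = ((a * x ^ 2 + 2 * g * x * y + d * y ^ 2 : ℝ) : ℂ) := by
      rw [hh, rowForm_smul_add_smul, ← ha, ← hd]
      push_cast at hg ⊢
      simp only [Complex.star_def, Complex.conj_ofReal]
      linear_combination (-x * y : ℂ) * hg
    rw [this]
    exact_mod_cast hq
  · have hM : M *ᵥ (F *ᵥ U.col k) = h 0 • w := by
      rw [mulVec_mulVec, hMF, add_mulVec, smul_mulVec, smul_mulVec, hAu, hBu, hh]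
      simp only [Pi.add_apply, Pi.smul_apply, smul_eq_mul]
      module
    have hN : N *ᵥ (F *ᵥ U.col k) = h 1 • w := by
      rw [mulVec_mulVec, hNF, add_mulVec, smul_mulVec, smul_mulVec, hAu, hBu, hh]
      simp only [Pi.add_apply, Pi.smul_apply, smul_eq_mul]
      module
    rw [pencil, sub_mulVec, smul_mulVec, smul_mulVec, hM, hN, hl]
    simp only [Pi.smul_apply, smul_eq_mul]
    module

/-- The Yakubovich lemma for a single pencil: positivity on the generalized eigenvectors implies
solvability of the matrix inequality. -/
theorem exists_lyapAdj_lt_of_forall_pencil {M N : Matrix ι κ ℂ} {G : Matrix κ κ ℂ}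
    {Θ₁ Θ₂ : Matrix (Fin 2) (Fin 2) ℂ} (hG : G.IsHermitian) (hΘ₁ : Θ₁.IsHermitian)
    (hΘ₂ : Θ₂.IsHermitian) (hdet : Θ₁.det ≠ 0)
    (hne : (thetaCurve Θ₁ ∩ thetaDomain Θ₂).Nontrivial)
    (hpos : ∀ z : κ → ℂ, z ≠ 0 → ∀ l ∈ thetaCurve Θ₁ ∩ thetaDomain Θ₂,
      pencil M N l *ᵥ z = 0 → 0 < (star z ⬝ᵥ G *ᵥ z).re) :
    ∃ H₁ H₂ : Matrix ι ι ℂ, H₁.IsHermitian ∧ H₂.PosDef ∧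
      (G - (lyapAdj M N Θ₁ H₁ + lyapAdj M N Θ₂ H₂)).PosDef := by
  classical
  by_contra! hcon
  set C : Set (Matrix κ κ ℂ) := {X | ∃ H₁ H₂ : Matrix ι ι ℂ, H₁.IsHermitian ∧ H₂.PosDef ∧
    X = G - (lyapAdj M N Θ₁ H₁ + lyapAdj M N Θ₂ H₂)} with hCdef
  have hsmulH {H : Matrix ι ι ℂ} (hH : H.IsHermitian) (a : ℝ) : (a • H).IsHermitian := by
    rw [IsHermitian, conjTranspose_smul, hH.eq]; simp
  have hCc : Convex ℝ C := by
    rintro _ ⟨H₁, H₂, h1, h2, rfl⟩ _ ⟨K₁, K₂, k1, k2, rfl⟩ a b ha hb hab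
    refine ⟨a • H₁ + b • K₁, a • H₂ + b • K₂, (hsmulH h1 a).add (hsmulH k1 b), ?_, ?_⟩
    · rcases ha.eq_or_lt with rfl | ha
      · obtain rfl : b = 1 := by linarith
        simpa using k2
      · exact (h2.smul ha).add_posSemidef (k2.posSemidef.smul hb)
    · rw [lyapAdj_smul_add_smul, lyapAdj_smul_add_smul]
      obtain rfl : b = 1 - a := by linarith
      module
  obtain ⟨F, hF, hFC⟩ := exists_re_trace_nonpos_of_forall_not_posDef hCc
    ⟨_, 0, 1, isHermitian_zero, PosDef.one, rfl⟩
    (by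
      rintro _ ⟨H₁, H₂, h1, h2, rfl⟩
      exact hG.sub ((isHermitian_lyapAdj M N hΘ₁ h1).add
        (isHermitian_lyapAdj M N hΘ₂ h2.isHermitian)))
    (by
      rintro _ ⟨H₁, H₂, h1, h2, rfl⟩
      exact hcon H₁ H₂ h1 h2)
  set L₁ := lyapGram (M * F) (N * F) Θ₁ with hL₁
  set L₂ := lyapGram (M * F) (N * F) Θ₂ with hL₂
  have hL₁H : L₁.IsHermitian := isHermitian_lyapGram _ _ hΘ₁
  have hL₂H : L₂.IsHermitian := isHermitian_lyapGram _ _ hΘ₂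
  have key {H₁ H₂ : Matrix ι ι ℂ} (h1 : H₁.IsHermitian) (h2 : H₂.PosDef) :
      (trace (Fᴴ * G * F)).re ≤ (trace (H₁ * L₁)).re + (trace (H₂ * L₂)).re := by
    have := hFC _ ⟨H₁, H₂, h1, h2, rfl⟩
    rw [Matrix.mul_sub, Matrix.sub_mul, Matrix.mul_add, Matrix.add_mul, trace_sub, trace_add,
      trace_lyapAdj, trace_lyapAdj, Complex.sub_re, Complex.add_re] at this
    linarith
  -- The two limits `t → ∞` and `t → 0` of the separation inequality.
  have hlin {b c : ℝ} (h : ∀ t : ℝ, 0 < t → b ≤ t * c) : 0 ≤ c := by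
    by_contra! hc
    have h1 := h ((|b| + 1) / (-c)) (div_pos (by positivity) (by linarith))
    rw [div_mul_eq_mul_div, div_neg, mul_div_cancel_right₀ _ hc.ne] at h1
    linarith [neg_abs_le b]
  have hlin' {b c : ℝ} (h : ∀ t : ℝ, 0 < t → b ≤ t * c) : b ≤ 0 := by
    by_contra! hb
    have h1 := h (b / (2 * (|c| + 1))) (by positivity)
    rw [div_mul_eq_mul_div, le_div_iff₀ (by positivity)] at h1
    nlinarith [le_abs_self c, abs_nonneg c]
  have hre (t : ℝ) (X Y : Matrix ι ι ℂ) : (trace ((t • X) * Y)).re = t * (trace (X * Y)).re := by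
    rw [Matrix.smul_mul, trace_smul, Complex.smul_re, smul_eq_mul]
  -- Testing with `H₁ = -t L₁` yields `tr L₁² ≤ 0`.
  have hL₁0 : L₁ = 0 := by
    have h0 : 0 ≤ (trace ((-L₁) * L₁)).re := by
      refine hlin (b := (trace (Fᴴ * G * F)).re - (trace (1 * L₂)).re) fun t ht => ?_
      have := key (hsmulH hL₁H.neg t) PosDef.one
      rw [hre] at this
      linarith
    have h1 : L₁ * L₁ = L₁ᴴ * L₁ := by rw [hL₁H.eq]
    rw [Matrix.neg_mul, h1, trace_neg, Complex.neg_re] at h0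
    have h2 := (posSemidef_conjTranspose_mul_self L₁).trace_nonneg
    rw [← trace_conjTranspose_mul_self_eq_zero_iff]
    rw [Complex.nonneg_iff] at h2
    exact Complex.ext (by simp only [Complex.zero_re]; linarith [h2.1]) h2.2.symm
  -- Testing with `H₂ = 1 + t x x^*` isolates `x^* L₂ x` as `t → ∞`.
  have hL₂P : L₂.PosSemidef := by
    refine PosSemidef.of_dotProduct_mulVec_nonneg hL₂H fun x => ?_
    rw [Complex.nonneg_iff]
    refine ⟨hlin (b := (trace (Fᴴ * G * F)).re - (trace (1 * L₂)).re) fun t ht => ?_,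
      (hL₂H.im_star_dotProduct_mulVec_self x).symm⟩
    have := key (H₂ := 1 + t • vecMulVec x (star x)) isHermitian_zero
      (PosDef.one.add_posSemidef ((posSemidef_vecMulVec_self_star x).smul ht.le))
    rw [Matrix.add_mul, trace_add, Complex.add_re, hre, hL₁0, vecMulVec_mul, trace_vecMulVec,
      dotProduct_comm, ← dotProduct_mulVec] at this
    simp only [Matrix.mul_zero, trace_zero, Complex.zero_re] at this
    linarith
  have hG0 : (trace (Fᴴ * G * F)).re ≤ 0 := by
    refine hlin' (c := (trace (1 * L₂)).re) fun t ht => ?_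
    have := key (H₂ := t • (1 : Matrix ι ι ℂ)) isHermitian_zero (PosDef.one.smul ht)
    rw [hre, hL₁0] at this
    simpa using this
  obtain ⟨U, hU, hk⟩ := exists_unitary_pencil_mulVec_eq_zero hΘ₁ hΘ₂ hdet hne hL₁0 hL₂P
  have htr : (trace (Fᴴ * G * F)).re =
      ∑ k, (star (F *ᵥ U.col k) ⬝ᵥ G *ᵥ (F *ᵥ U.col k)).re := by
    have h1 : trace (Fᴴ * G * F) = trace ((F * U)ᴴ * G * (F * U)) := by
      rw [conjTranspose_mul, Matrix.trace_mul_comm (Uᴴ * Fᴴ * G), Matrix.mul_assoc F U,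
        Matrix.mul_assoc Uᴴ, ← Matrix.mul_assoc U, hU, Matrix.one_mul,
        Matrix.trace_mul_comm F]
    rw [h1, trace, Complex.re_sum]
    refine Finset.sum_congr rfl fun k _ => ?_
    congr 1
    rw [diag_apply, Matrix.mul_assoc, mul_apply, dotProduct]
    refine Finset.sum_congr rfl fun i _ => ?_
    have hcol : (F * U).col k = F *ᵥ U.col k := rfl
    rw [← hcol]
    rfl
  have hnn (k : κ) : 0 ≤ (star (F *ᵥ U.col k) ⬝ᵥ G *ᵥ (F *ᵥ U.col k)).re := by
    obtain ⟨l, hl, hz⟩ := hk k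
    by_cases h0 : F *ᵥ U.col k = 0
    · simp [h0]
    · exact (hpos _ h0 l hl hz).le
  -- The terms are nonnegative with sum at most `0`, while a nonzero `F u` would contribute a
  -- positive one.
  have hz (k : κ) : F *ᵥ U.col k = 0 := by
    by_contra h0
    obtain ⟨l, hl, hz⟩ := hk k
    have h1 := Finset.single_le_sum (fun k _ => hnn k) (Finset.mem_univ k)
    linarith [hpos _ h0 l hl hz]
  apply hF
  have hFU : F * U = 0 := by
    ext i k
    exact congr_fun (hz k) i
  rw [← Matrix.mul_one F, ← hU, ← Matrix.mul_assoc, hFU, Matrix.zero_mul]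

end Lyapunov

/-! ### From the matrix inequality to positivity on kernel vectors. -/

section Necessity

variable {ι κ : Type*} [Fintype κ]

theorem exists_mulVec_eq_homCoord_smul {M N : Matrix ι κ ℂ} {l : OnePoint ℂ} {z : κ → ℂ}
    (h : pencil M N l *ᵥ z = 0) :
    ∃ w : ι → ℂ, M *ᵥ z = homCoord l 0 • w ∧ N *ᵥ z = homCoord l 1 • w := by
  rw [pencil, sub_mulVec, smul_mulVec, smul_mulVec, sub_eq_zero] at h
  induction l using OnePoint.rec with
  | infty => exact ⟨M *ᵥ z, by simpa [homCoord] using h⟩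
  | coe c => exact ⟨N *ᵥ z, by simpa [homCoord] using h.symm⟩

variable [Fintype ι]

/-- On a kernel vector the form factors, so the `Θ₁` term vanishes on `Γ` and the `Θ₂` term is
nonnegative on `Ω` when `H₂ > 0`. -/
theorem star_dotProduct_lyapAdj_mulVec {M N : Matrix ι κ ℂ} {Θ : Matrix (Fin 2) (Fin 2) ℂ}
    {H : Matrix ι ι ℂ} {l : OnePoint ℂ} {z : κ → ℂ} {w : ι → ℂ}
    (hM : M *ᵥ z = homCoord l 0 • w) (hN : N *ᵥ z = homCoord l 1 • w) :
    star z ⬝ᵥ lyapAdj M N Θ H *ᵥ z = thetaForm Θ l * (star w ⬝ᵥ H *ᵥ w) := by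
  have h (X Y : Matrix ι κ ℂ) :
      star z ⬝ᵥ (Xᴴ * H * Y) *ᵥ z = star (X *ᵥ z) ⬝ᵥ H *ᵥ (Y *ᵥ z) := by
    rw [star_mulVec, ← dotProduct_mulVec, mulVec_mulVec, mulVec_mulVec, Matrix.mul_assoc]
  have hform : thetaForm Θ l = rowForm Θ (homCoord l) (homCoord l) := rfl
  simp only [lyapAdj_eq, add_mulVec, smul_mulVec, dotProduct_add, dotProduct_smul, h, hM, hN,
    mulVec_smul, star_smul, smul_dotProduct, smul_eq_mul]
  rw [hform, rowForm_eq]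
  ring

theorem re_quadratic_pos_of_lyapAdj_lt {M N : Matrix ι κ ℂ} {G : Matrix κ κ ℂ}
    {Θ₁ Θ₂ : Matrix (Fin 2) (Fin 2) ℂ} {H₁ H₂ : Matrix ι ι ℂ} (hH₂ : H₂.PosDef)
    (h : (G - (lyapAdj M N Θ₁ H₁ + lyapAdj M N Θ₂ H₂)).PosDef) {l : OnePoint ℂ}
    (hl : l ∈ thetaCurve Θ₁ ∩ thetaDomain Θ₂) {z : κ → ℂ} (hz0 : z ≠ 0)
    (hz : pencil M N l *ᵥ z = 0) : 0 < (star z ⬝ᵥ G *ᵥ z).re := by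
  obtain ⟨w, hM, hN⟩ := exists_mulVec_eq_homCoord_smul hz
  have h1 := h.dotProduct_mulVec_pos hz0
  have hl1 : thetaForm Θ₁ l = 0 := hl.1
  rw [sub_mulVec, add_mulVec, dotProduct_sub, dotProduct_add,
    star_dotProduct_lyapAdj_mulVec hM hN, star_dotProduct_lyapAdj_mulVec hM hN, hl1, zero_mul,
    zero_add] at h1
  have h2 := mul_nonneg hl.2 (hH₂.posSemidef.dotProduct_mulVec_nonneg w)
  exact (Complex.pos_iff.1 (h2.trans_lt (sub_pos.1 h1))).1

end Necessity

/-! ### Block matrices and the theorem at a fixed parameter. -/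

section Blocks

variable {m n k : ℕ}

theorem pencil_one_kronecker_mulVec (M N : Matrix (Fin n) (Fin k) ℂ) (l : OnePoint ℂ)
    (Z : Fin m × Fin k → ℂ) (i : Fin m) (a : Fin n) :
    (pencil ((1 : Matrix (Fin m) (Fin m) ℂ) ⊗ₖ M) ((1 : Matrix (Fin m) (Fin m) ℂ) ⊗ₖ N) l *ᵥ Z)
      (i, a) = (pencil M N l *ᵥ fun b => Z (i, b)) a := by
  have h (X : Matrix (Fin n) (Fin k) ℂ) :
      (((1 : Matrix (Fin m) (Fin m) ℂ) ⊗ₖ X) *ᵥ Z) (i, a) = (X *ᵥ fun b => Z (i, b)) a := by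
    simp [mulVec, dotProduct, Fintype.sum_prod_type, one_apply]
  simp only [pencil, sub_mulVec, smul_mulVec, Pi.sub_apply, Pi.smul_apply, h]

theorem star_dotProduct_blockMat_mulVec (G : Fin m → Fin m → Matrix (Fin k) (Fin k) ℂ)
    (v : Fin m → ℂ) (z : Fin k → ℂ) :
    star (fun a : Fin m × Fin k => v a.1 * z a.2) ⬝ᵥ
      blockMat G *ᵥ (fun a : Fin m × Fin k => v a.1 * z a.2) = star v ⬝ᵥ quadMat G z *ᵥ v := by
  simp only [dotProduct, mulVec, Fintype.sum_prod_type, blockMat, quadMat, of_apply, Pi.star_apply,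
    star_mul', Finset.mul_sum, Finset.sum_mul]
  refine Finset.sum_congr rfl fun i _ => ?_
  rw [Finset.sum_comm]
  refine Finset.sum_congr rfl fun j _ => Finset.sum_congr rfl fun a _ =>
    Finset.sum_congr rfl fun b _ => ?_
  ring

theorem isHermitian_blockMat {G : Fin m → Fin m → Matrix (Fin k) (Fin k) ℂ}
    (hG : ∀ i j, G i j = (G j i)ᴴ) : (blockMat G).IsHermitian := by
  ext a b
  have := congr_fun (congr_fun (hG a.1 b.1) a.2) b.2
  rw [conjTranspose_apply] at this
  simp [blockMat, this]

theorem isHermitian_quadMat {G : Fin m → Fin m → Matrix (Fin k) (Fin k) ℂ}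
    (hG : ∀ i j, G i j = (G j i)ᴴ) (z : Fin k → ℂ) : (quadMat G z).IsHermitian := by
  ext i j
  simp only [conjTranspose_apply, quadMat, of_apply]
  rw [← star_dotProduct_star, star_star, star_mulVec, ← hG i j, ← dotProduct_mulVec]

/-- If the rank of `A` is one less than the number of its columns, its null space is a line. -/
theorem exists_forall_mulVec_eq_zero_eq_smul {A : Matrix (Fin n) (Fin (n + 1)) ℂ}
    (hA : A.rank = n) :
    ∃ y : Fin (n + 1) → ℂ, y ≠ 0 ∧ A *ᵥ y = 0 ∧ ∀ z, A *ᵥ z = 0 → ∃ c : ℂ, z = c • y := by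
  have h := A.mulVecLin.finrank_range_add_finrank_ker
  rw [show Module.finrank ℂ A.mulVecLin.range = n from hA, Module.finrank_fin_fun] at h
  obtain ⟨y, hy0, hy⟩ := finrank_eq_one_iff'.1 (Nat.add_left_cancel h)
  refine ⟨y, by simpa using hy0, y.2, fun z hz => ?_⟩
  obtain ⟨c, hc⟩ := hy ⟨z, hz⟩
  exact ⟨c, (congr_arg Subtype.val hc).symm⟩

/-- The Yakubovich lemma without parameters. -/
theorem forall_quadMat_posDef_iff_exists_satisfiesLMI
    {G : Fin m → Fin m → Matrix (Fin k) (Fin k) ℂ} (hG : ∀ i j, G i j = (G j i)ᴴ)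
    {M N : Matrix (Fin n) (Fin k) ℂ} {Θ₁ Θ₂ : Matrix (Fin 2) (Fin 2) ℂ} (hΘ₁ : Θ₁.IsHermitian)
    (hΘ₂ : Θ₂.IsHermitian) (hdet : Θ₁.det ≠ 0)
    (hne : (thetaCurve Θ₁ ∩ thetaDomain Θ₂).Nontrivial)
    (hdim : m = 1 ∨ (k = n + 1 ∧ ∀ l ∈ thetaCurve Θ₁ ∩ thetaDomain Θ₂, (pencil M N l).rank = n)) :
    (∀ z : Fin k → ℂ, z ≠ 0 → ∀ l ∈ thetaCurve Θ₁ ∩ thetaDomain Θ₂,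
      pencil M N l *ᵥ z = 0 → (quadMat G z).PosDef) ↔
    ∃ H₁ H₂ : Matrix (Fin m × Fin n) (Fin m × Fin n) ℂ, H₁.IsHermitian ∧
      SatisfiesLMI G M N Θ₁ Θ₂ H₁ H₂ := by
  constructor
  · intro h
    refine exists_lyapAdj_lt_of_forall_pencil
      (M := (1 : Matrix (Fin m) (Fin m) ℂ) ⊗ₖ M) (N := (1 : Matrix (Fin m) (Fin m) ℂ) ⊗ₖ N)
      (isHermitian_blockMat hG) hΘ₁ hΘ₂ hdet hne ?_
    intro Z hZ l hl hZl
    have hker (i : Fin m) : pencil M N l *ᵥ (fun b => Z (i, b)) = 0 := by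
      ext a
      rw [← pencil_one_kronecker_mulVec, hZl, Pi.zero_apply, Pi.zero_apply]
    -- The kernel vector is an elementary tensor `v ⊗ y`: trivially for one block, and otherwise
    -- because every block lies on the one-dimensional kernel of the pencil.
    obtain ⟨v, y, hy, hv⟩ : ∃ (v : Fin m → ℂ) (y : Fin k → ℂ), pencil M N l *ᵥ y = 0 ∧
        Z = fun a => v a.1 * y a.2 := by
      rcases hdim with rfl | ⟨rfl, hrank⟩
      · refine ⟨1, fun b => Z (0, b), hker 0, ?_⟩
        ext ⟨i, b⟩
        rw [Subsingleton.elim i 0]; simp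
      · obtain ⟨y, -, hy, hall⟩ := exists_forall_mulVec_eq_zero_eq_smul (hrank l hl)
        choose v hv using fun i => hall _ (hker i)
        exact ⟨v, y, hy, funext fun a => congr_fun (hv a.1) a.2⟩
    have hy0 : y ≠ 0 := by
      rintro rfl
      exact hZ (by rw [hv]; ext; simp)
    have hv0 : v ≠ 0 := by
      rintro rfl
      exact hZ (by rw [hv]; ext; simp)
    rw [hv, star_dotProduct_blockMat_mulVec]
    exact (h y hy0 l hl hy).re_dotProduct_pos hv0
  · rintro ⟨H₁, H₂, -, h2, h3⟩ z hz l hl hzl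
    rw [(isHermitian_quadMat hG z).posDef_iff_re_quadratic_pos]
    intro v hv
    rw [← star_dotProduct_blockMat_mulVec]
    refine re_quadratic_pos_of_lyapAdj_lt h2 h3 hl ?_ ?_
    · obtain ⟨i, hi⟩ := Function.ne_iff.1 hv
      obtain ⟨b, hb⟩ := Function.ne_iff.1 hz
      exact Function.ne_iff.2 ⟨(i, b), mul_ne_zero hi hb⟩
    · ext ⟨i, a⟩
      rw [pencil_one_kronecker_mulVec]
      have : (fun b => v i * z b) = v i • z := rfl
      rw [this, mulVec_smul, hzl]
      simp

end Blocks

/-! ### Openness and convexity of the solution set. -/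

section Continuity

variable {m n k : ℕ}

theorem isOpen_setOf_posDef {Y κ : Type*} [TopologicalSpace Y] [Fintype κ] {X : Y → Matrix κ κ ℂ}
    (hX : Continuous X) (hH : ∀ y, (X y).IsHermitian) : IsOpen {y | (X y).PosDef} := by
  simp only [fun y => (hH y).posDef_iff_re_quadratic_pos]
  exact isOpen_setOf_re_quadratic_pos hX

theorem Continuous.one_kronecker {Y : Type*} [TopologicalSpace Y] {X : Y → Matrix (Fin n) (Fin k) ℂ}
    (hX : Continuous X) : Continuous fun y => (1 : Matrix (Fin m) (Fin m) ℂ) ⊗ₖ X y :=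
  continuous_matrix fun a b =>
    continuous_const.mul (hX.matrix_elem a.2 b.2)

theorem Continuous.lyapAdj {Y ι κ : Type*} [TopologicalSpace Y] [Fintype ι]
    {M N : Y → Matrix ι κ ℂ} {Θ : Y → Matrix (Fin 2) (Fin 2) ℂ} {H : Y → Matrix ι ι ℂ}
    (hM : Continuous M) (hN : Continuous N) (hΘ : Continuous Θ) (hH : Continuous H) :
    Continuous fun y => lyapAdj (M y) (N y) (Θ y) (H y) := by
  simp only [lyapAdj_eq]
  have h {A B : Y → Matrix ι κ ℂ} (hA : Continuous A) (hB : Continuous B) (i j : Fin 2) :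
      Continuous fun y => Θ y i j • ((A y)ᴴ * H y * B y) :=
    (hΘ.matrix_elem i j).smul ((hA.matrix_conjTranspose.matrix_mul hH).matrix_mul hB)
  exact (((h hM hM 0 0).add (h hM hN 1 0)).add (h hN hM 0 1)).add (h hN hN 1 1)

theorem isOpen_setOf_satisfiesLMI {Y : Type*} [TopologicalSpace Y]
    {G : Y → Fin m → Fin m → Matrix (Fin k) (Fin k) ℂ} {M N : Y → Matrix (Fin n) (Fin k) ℂ}
    {Θ₁ Θ₂ : Y → HermMat (Fin 2)} {H₁ H₂ : Y → HermMat (Fin m × Fin n)}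
    (hG : Continuous G) (hM : Continuous M) (hN : Continuous N) (hΘ₁ : Continuous Θ₁)
    (hΘ₂ : Continuous Θ₂) (hH₁ : Continuous H₁) (hH₂ : Continuous H₂)
    (hherm : ∀ y i j, G y i j = (G y j i)ᴴ) :
    IsOpen {y | SatisfiesLMI (G y) (M y) (N y) (Θ₁ y).1 (Θ₂ y).1 (H₁ y).1 (H₂ y).1} := by
  have hv {κ : Type} {X : Y → HermMat κ} (hX : Continuous X) : Continuous fun y => (X y).1 :=
    continuous_subtype_val.comp hX
  have hb : Continuous fun y => blockMat (G y) :=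
    continuous_matrix fun a b =>
      ((continuous_apply b.1).comp ((continuous_apply a.1).comp hG)).matrix_elem a.2 b.2
  refine (isOpen_setOf_posDef (hv hH₂) fun y => (H₂ y).2).inter
    (isOpen_setOf_posDef (hb.sub ?_) fun y => ?_)
  · exact (hM.one_kronecker.lyapAdj hN.one_kronecker (hv hΘ₁) (hv hH₁)).add
      (hM.one_kronecker.lyapAdj hN.one_kronecker (hv hΘ₂) (hv hH₂))
  · exact (isHermitian_blockMat (hherm y)).sub
      ((isHermitian_lyapAdj _ _ (Θ₁ y).2 (H₁ y).2).add (isHermitian_lyapAdj _ _ (Θ₂ y).2 (H₂ y).2))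

theorem convex_setOf_satisfiesLMI (G : Fin m → Fin m → Matrix (Fin k) (Fin k) ℂ)
    (M N : Matrix (Fin n) (Fin k) ℂ) (Θ₁ Θ₂ : Matrix (Fin 2) (Fin 2) ℂ) :
    Convex ℝ {H : HermMat (Fin m × Fin n) × HermMat (Fin m × Fin n) |
      SatisfiesLMI G M N Θ₁ Θ₂ H.1.1 H.2.1} := by
  have hcomb {κ : Type} [Fintype κ] {X Y : Matrix κ κ ℂ} (hX : X.PosDef) (hY : Y.PosDef) {a b : ℝ}
      (ha : 0 ≤ a) (hb : 0 ≤ b) (hab : a + b = 1) : (a • X + b • Y).PosDef := by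
    rcases ha.eq_or_lt with rfl | ha
    · obtain rfl : b = 1 := by linarith
      simpa using hY
    · exact (hX.smul ha).add_posSemidef (hY.posSemidef.smul hb)
  rintro ⟨H₁, H₂⟩ ⟨h1, h2⟩ ⟨K₁, K₂⟩ ⟨k1, k2⟩ a b ha hb hab
  refine ⟨hcomb h1 k1 ha hb hab, ?_⟩
  convert hcomb h2 k2 ha hb hab using 1
  have hval (A B : HermMat (Fin m × Fin n)) : (a • A + b • B).1 = a • A.1 + b • B.1 := rfl
  simp only [Prod.smul_mk, Prod.mk_add_mk, hval, lyapAdj_smul_add_smul]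
  obtain rfl : b = 1 - a := by linarith
  module

instance {κ : Type*} : ContinuousSMul ℝ (HermMat κ) :=
  ⟨(continuous_fst.smul (continuous_subtype_val.comp continuous_snd)).subtype_mk _⟩

/-- For a compact domain, an open condition on the graph is open in the space of continuous
maps. -/
theorem isOpen_setOf_forall_graph_mem {D E : Type*} [TopologicalSpace D] [CompactSpace D]
    [UniformSpace E] {U : Set (D × E)} (hU : IsOpen U) :
    IsOpen {H : C(D, E) | ∀ p, (p, H p) ∈ U} := by
  rw [isOpen_iff_eventually]
  intro H₀ hH₀
  have := isCompact_univ.eventually_forall_of_forall_eventually (x₀ := H₀)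
    (K := (Set.univ : Set D)) (P := fun H p => (p, H p) ∈ U) fun p _ => ?_
  · exact this.mono fun H hH p => hH p (Set.mem_univ p)
  -- Joint continuity of evaluation comes from uniform convergence, so `D` need not be Hausdorff.
  have hev : Filter.Tendsto (fun z : C(D, E) × D => z.1 z.2) (nhds (H₀, p)) (nhds (H₀ p)) := by
    refine tendsto_comp_of_locally_uniform_limit (F := fun z : C(D, E) × D => z.1)
      H₀.continuous.continuousAt continuous_snd.continuousAt fun u hu => ?_
    refine ⟨Set.univ, Filter.univ_mem, ?_⟩
    have h1 := ContinuousMap.tendsto_iff_tendstoUniformly.1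
      
      ((continuous_fst (X := C(D, E)) (Y := D)).continuousAt (x := (H₀, p))) u hu
    exact h1.mono fun z hz y _ => hz y
  exact ((continuous_snd.continuousAt (x := (H₀, p))).prodMk_nhds hev).eventually
    (hU.mem_nhds (hH₀ p))

end Continuity

theorem theorem6 {D : Type*} [TopologicalSpace D] [CompactSpace D] (m n nz : ℕ)
    (G : Fin m → Fin m → C(D, Matrix (Fin nz) (Fin nz) ℂ))
    (hG : ∀ p i j, G i j p = (G j i p).conjTranspose)
    (M N : C(D, Matrix (Fin n) (Fin nz) ℂ))
    (Θ₁ Θ₂ : C(D, HermMat (Fin 2)))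
    (hΘ₁ : ∀ p, (Θ₁ p).1.det < 0) (hΘ₂ : ∀ p, (Θ₂ p).1.det < 0)
    (hΓΩ : ∀ p, (thetaCurve (Θ₁ p).1 ∩ thetaDomain (Θ₂ p).1).Nontrivial)
    (hdim : (m = 1 ∧ n < nz) ∨
      (1 < m ∧ nz = n + 1 ∧
        ∀ p, ∀ l ∈ thetaCurve (Θ₁ p).1 ∩ thetaDomain (Θ₂ p).1,
          (pencil (M p) (N p) l).rank = n)) :
    ((∀ p, ∀ z : Fin nz → ℂ, z ≠ 0 →
        ∀ l ∈ thetaCurve (Θ₁ p).1 ∩ thetaDomain (Θ₂ p).1,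
          Matrix.mulVec (pencil (M p) (N p) l) z = 0 →
            (quadMat (fun i j => G i j p) z).PosDef) ↔
      ∃ H₁ H₂ : C(D, HermMat (Fin m × Fin n)), ∀ p,
        SatisfiesLMI (fun i j => G i j p) (M p) (N p) (Θ₁ p).1 (Θ₂ p).1 (H₁ p).1 (H₂ p).1) ∧
    IsOpen {H : C(D, HermMat (Fin m × Fin n) × HermMat (Fin m × Fin n)) | ∀ p,
      SatisfiesLMI (fun i j => G i j p) (M p) (N p) (Θ₁ p).1 (Θ₂ p).1 (H p).1.1 (H p).2.1} := by
  have hlocal (p : D) := forall_quadMat_posDef_iff_exists_satisfiesLMI (fun i j => hG p i j)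
    (Θ₁ p).2 (Θ₂ p).2 (hΘ₁ p).ne (hΓΩ p) (M := M p) (N := N p)
    (hdim.imp And.left fun h => ⟨h.2.1, h.2.2 p⟩)
  refine ⟨⟨fun h => ?_, ?_⟩, ?_⟩
  · let Φ : D → (Fin m → Fin m → Matrix (Fin nz) (Fin nz) ℂ) ×
        (Matrix (Fin n) (Fin nz) ℂ × Matrix (Fin n) (Fin nz) ℂ) ×
        (HermMat (Fin 2) × HermMat (Fin 2)) :=
      fun p => (fun i j => G i j p, (M p, N p), (Θ₁ p, Θ₂ p))
    have hΦ : Continuous Φ := by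
      refine Continuous.prodMk ?_ ((M.continuous.prodMk N.continuous).prodMk
        (Θ₁.continuous.prodMk Θ₂.continuous))
      exact continuous_pi fun i => continuous_pi fun j => (G i j).continuous
    have : CompactSpace (Set.range Φ) := isCompact_iff_compactSpace.1 (isCompact_range hΦ)
    obtain ⟨g, hg⟩ := exists_continuous_forall_mem_convex_of_local_const
      (X := Set.range Φ) (E := HermMat (Fin m × Fin n) × HermMat (Fin m × Fin n))
      (t := fun x => {H | SatisfiesLMI x.1.1 x.1.2.1.1 x.1.2.1.2 x.1.2.2.1.1 x.1.2.2.2.1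
        H.1.1 H.2.1})
      (fun x => convex_setOf_satisfiesLMI _ _ _ _ _) (by
        rintro ⟨_, p, rfl⟩
        obtain ⟨H₁, H₂, h1, h2⟩ := (hlocal p).1 (h p)
        refine ⟨(⟨H₁, h1⟩, ⟨H₂, h2.1.isHermitian⟩), ?_⟩
        have hc : Continuous (Subtype.val : Set.range Φ → _) := continuous_subtype_val
        have ho := isOpen_setOf_satisfiesLMI (Y := Set.range Φ) (G := fun x => x.1.1)
          (M := fun x => x.1.2.1.1) (N := fun x => x.1.2.1.2) (Θ₁ := fun x => x.1.2.2.1)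
          (Θ₂ := fun x => x.1.2.2.2) (H₁ := fun _ => ⟨H₁, h1⟩)
          (H₂ := fun _ => ⟨H₂, h2.1.isHermitian⟩) hc.fst hc.snd.fst.fst hc.snd.fst.snd
          hc.snd.snd.fst hc.snd.snd.snd continuous_const continuous_const (by
            rintro ⟨_, q, rfl⟩ i j
            exact hG q i j)
        exact ho.mem_nhds h2)
    have hgΦ : Continuous fun p => g ⟨Φ p, Set.mem_range_self p⟩ :=
      g.continuous.comp (hΦ.subtype_mk _)
    exact ⟨⟨_, hgΦ.fst⟩, ⟨_, hgΦ.snd⟩, fun p => hg ⟨Φ p, Set.mem_range_self p⟩⟩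
  · rintro ⟨H₁, H₂, hH⟩ p
    exact (hlocal p).2 ⟨_, _, (H₁ p).2, hH p⟩
  · refine isOpen_setOf_forall_graph_mem
      (U := {x : D × (HermMat (Fin m × Fin n) × HermMat (Fin m × Fin n)) |
        SatisfiesLMI (fun i j => G i j x.1) (M x.1) (N x.1) (Θ₁ x.1).1 (Θ₂ x.1).1
          x.2.1.1 x.2.2.1}) ?_
    have hc := continuous_fst (X := D) (Y := HermMat (Fin m × Fin n) × HermMat (Fin m × Fin n))
    exact isOpen_setOf_satisfiesLMI
      (continuous_pi fun i => continuous_pi fun j => (G i j).continuous.comp hc)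
      (M.continuous.comp hc) (N.continuous.comp hc) (Θ₁.continuous.comp hc)
      (Θ₂.continuous.comp hc) continuous_snd.fst continuous_snd.snd fun x i j => hG x.1 i j
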